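/- **Setting.** Fix a finite set $\mathcal P$ of participants and a finite message alphabet $\Sigma$. Channels are the pairs $pq$ with $p\neq q$ in $\mathcal P$. Actions are $pq!a$ (participant $p$ sends $a$ to $q$) and $pq?a$ (participant $q$ receives $a$ from $p$), where $a\in\Sigma$; $pq!a$ is executed by its subject $p$, and $pq?a$ by its subject $q$. A system $S=(M_p)_{p\in\mathcal P}$ assigns to each $p$ a finite automaton $M_p=(Q_p,q_{0p},\delta_p)$ whose transitions are labelled by actions with subject $p$. Each $M_p$ is assumed to be deterministic, to have no mixed states (each state is final, or sending, i.e. non-final with only send transitions, or receiving, i.e. non-final with only receive transitions), and to be *directed*: all transitions leaving a given state have the same communication partner. A configuration is $s=(\vec q;\vec w)$ with a local state $q_p$ for each $p$ and a FIFO queue $w_{pq}\in\Sigma^*$ for each channel. The action $pq!a$ moves $p$ along a transition and appends $a$ to $w_{pq}$; $pq?a$ moves $q$ along a transition and removes $a$ from the head of $w_{pq}$. In the initial configuration $s_0$ all automata are in their initial states and all queues are empty. A configuration is stable if all its queues are empty, and $k$-bounded if all its queues have length at most $k$. Write $s\xrightarrow{\varphi}_k s'$ if the word of actions $\varphi$ leads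 from $s$ to $s'$ through $k$-bounded configurations only (including $s$ and $s'$), and omit $s'$ if it is existentially quantified. Let $RS_k(S)$ be the set of all $s$ with $s_0\xrightarrow{\varphi}_k s$ for some $\varphi$. For $k\ge 1$: * $S$ is *$k$-safe* if for all $s=(\vec q;\vec w)\in RS_k(S)$: (i) if $w_{pq}$ has head $a$, then $s\xrightarrow{\varphi}_k\xrightarrow{pq?a}_k$ for some $\varphi$; (ii) if $q_p$ is receiving, then $s\xrightarrow{\varphi}_k\xrightarrow{qp?a}_k$ for some $\varphi$, $q$, $a$. * $S$ is *$k$-exhaustive* if for all $s=(\vec q;\vec w)\in RS_k(S)$ and all $p$ with $q_p$ sending, and every $(q_p,\ell,q'_p)\in\delta_p$, there is $\varphi$ without actions of $p$ such that $s\xrightarrow{\varphi}_k\xrightarrow{\ell}_k$. * $S$ is *$k$-multiparty compatible* ($k$-MC) if it is $k$-safe and $k$-exhaustive. A word is synchronous if it is a concatenation of words $pq!a\cdot pq?a$. Let $RS_0(S)$ be the set of configurations reached from $s_0$ by a 1-bounded execution $\varphi$ or $\varphi\cdot pq!a$ with $\varphi$ synchronous. The synchronous transition system on $RS_0(S)$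 has, for all $s,s',s''\in RS_0(S)$ with $s\xrightarrow{pq!a}_1 s'\xrightarrow{pq?a}_1 s''$, the transitions $s\xrightarrow{pq!a}_0 s'$ and $s'\xrightarrow{pq?a}_0 s''$, and no others. $S$ is *synchronous multiparty compatible* (SMC) if for all stable $s=(\vec q;\vec w)\in RS_0(S)$ and all $p\in\mathcal P$: if $q_p$ is sending, then for every $(q_p,\ell,q')\in\delta_p$ there is a synchronous $\varphi$ with $s\xrightarrow{\varphi}_0$ whose subsequence of actions of $p$ is exactly $\ell$; if $q_p$ is receiving, then the same holds for at least one $(q_p,\ell,q')\in\delta_p$. **Theorem.** Every SMC system (of directed, deterministic automata without mixed states) is $1$-MC. Hence $k$-MC strictly extends SMC: for every $k\ge1$, every such SMC system is $k$-MC, and there is such a system that is $k$-MC but not SMC. -/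

import Mathlib

universe u v w

namespace CommAut

/-- Channels: ordered pairs `pq` of distinct participants (`p` writes, `q` reads). -/
abbrev Channel (P : Type u) : Type u := {c : P × P // c.1 ≠ c.2}

/-- The participant that writes to the channel. -/
def Channel.src {P : Type u} (c : Channel P) : P := c.1.1

/-- The participant that reads from the channel. -/
def Channel.tgt {P : Type u} (c : Channel P) : P := c.1.2

/-- Actions: `send pq a` is `pq!a`, and `recv pq a` is `pq?a`. -/
inductive Action (P : Type u) (A : Type v) : Type (max u v)
  | send (c : Channel P) (a : A) : Action P A
  | recv (c : Channel P) (a : A) : Action P A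

namespace Action

variable {P : Type u} {A : Type v}

/-- The participant that executes the action. -/
def subj : Action P A → P
  | send c _ => c.src
  | recv c _ => c.tgt

/-- The other participant of the action. -/
def obj : Action P A → P
  | send c _ => c.tgt
  | recv c _ => c.src

def IsSend : Action P A → Prop
  | send _ _ => True
  | recv _ _ => False

def IsRecv : Action P A → Prop
  | send _ _ => False
  | recv _ _ => True

end Action

/-- The projection of a word of actions onto the participant `p`. -/
noncomputable def proj {P : Type u} {A : Type v} (p : P) (φ : List (Action P A)) :
    List (Action P A) :=
  letI := Classical.decEq P
  φ.filter (fun l => l.subj = p)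

/-- `p ∉ φ`: no action of the word `φ` is executed by `p`. -/
def NotIn {P : Type u} {A : Type v} (p : P) (φ : List (Action P A)) : Prop :=
  ∀ l ∈ φ, l.subj ≠ p

/-- Synchronous words: every send is immediately followed by the matching receive. -/
inductive IsSync {P : Type u} {A : Type v} : List (Action P A) → Prop
  | nil : IsSync []
  | cons (c : Channel P) (a : A) (φ : List (Action P A)) :
      IsSync φ → IsSync (Action.send c a :: Action.recv c a :: φ)

/-- A communicating automaton over participants `P` and messages `A`. -/
structure Automaton (P : Type u) (A : Type v) where
  State : Type w
  finite_state : Finite State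
  init : State
  δ : Set (State × Action P A × State)

namespace Automaton

variable {P : Type u} {A : Type v} (M : Automaton.{u, v, w} P A)

def IsFinal (q : M.State) : Prop := ∀ l q', (q, l, q') ∉ M.δ

def IsSending (q : M.State) : Prop :=
  ¬ M.IsFinal q ∧ ∀ l q', (q, l, q') ∈ M.δ → l.IsSend

def IsReceiving (q : M.State) : Prop :=
  ¬ M.IsFinal q ∧ ∀ l q', (q, l, q') ∈ M.δ → l.IsRecv

def IsMixed (q : M.State) : Prop :=
  ¬ M.IsFinal q ∧ ¬ M.IsSending q ∧ ¬ M.IsReceiving q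

def IsDeterministic : Prop :=
  ∀ q l l' q' q'', (q, l, q') ∈ M.δ → (q, l', q'') ∈ M.δ → l = l' → q' = q''

def IsSendDirected : Prop :=
  ∀ q l l' q' q'', M.IsSending q → (q, l, q') ∈ M.δ → (q, l', q'') ∈ M.δ → l.obj = l'.obj

def IsReceiveDirected : Prop :=
  ∀ q l l' q' q'', M.IsReceiving q → (q, l, q') ∈ M.δ → (q, l', q'') ∈ M.δ → l.obj = l'.obj

def IsDirected : Prop := M.IsSendDirected ∧ M.IsReceiveDirected

end Automaton

/-- A system: one communicating automaton for every participant. -/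
abbrev System (P : Type u) (A : Type v) : Type (max u v (w + 1)) := P → Automaton.{u, v, w} P A

namespace System

variable {P : Type u} {A : Type v} (S : System.{u, v, w} P A)

/-- Systems of communicating session automata: all transitions of the automaton of `p` are
executed by `p`, and every automaton is deterministic and has no mixed state. -/
def IsCSA : Prop :=
  ∀ p, (∀ q l q', (q, l, q') ∈ (S p).δ → l.subj = p) ∧
    (S p).IsDeterministic ∧ ∀ q, ¬ (S p).IsMixed q

def IsDirected : Prop := ∀ p, (S p).IsDirected

/-- Configurations: a local state for every participant and a queue for every channel
(messages are written at the end of the list and read at its head). -/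
@[ext]
structure Config where
  state : ∀ p, (S p).State
  queue : Channel P → List A

/-- The initial configuration. -/
def initial : S.Config where
  state := fun p => (S p).init
  queue := fun _ => []

variable {S}

/-- All queues are empty. -/
def Config.IsStable (s : S.Config) : Prop := ∀ c, s.queue c = []

def Config.IsBounded (s : S.Config) (k : ℕ) : Prop := ∀ c, (s.queue c).length ≤ k

variable (S)

/-- The (unbounded, asynchronous) transition relation on configurations. -/
def Step (s : S.Config) : Action P A → S.Config → Prop
  | .send c a, s' =>
      (s.state c.src, Action.send c a, s'.state c.src) ∈ (S c.src).δ ∧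
      (∀ p, p ≠ c.src → s'.state p = s.state p) ∧
      s'.queue c = s.queue c ++ [a] ∧ ∀ d, d ≠ c → s'.queue d = s.queue d
  | .recv c a, s' =>
      (s.state c.tgt, Action.recv c a, s'.state c.tgt) ∈ (S c.tgt).δ ∧
      (∀ p, p ≠ c.tgt → s'.state p = s.state p) ∧
      s.queue c = a :: s'.queue c ∧ ∀ d, d ≠ c → s'.queue d = s.queue d

/-- `BExec k s φ s'`: `s'` is reached from `s` by the execution `φ`, all of whose configurations,
`s` and `s'` included, are `k`-bounded. -/
def BExec (k : ℕ) : S.Config → List (Action P A) → S.Config → Prop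
  | s, [], s' => s.IsBounded k ∧ s' = s
  | s, l :: φ, s' => s.IsBounded k ∧ ∃ t, S.Step s l t ∧ BExec k t φ s'

/-- The `k`-reachability set. -/
def RS (k : ℕ) : Set S.Config := {s | ∃ φ, S.BExec k S.initial φ s}

/-- Eventual reception and progress within the bound `k`. -/
def IsSafe (k : ℕ) : Prop :=
  ∀ s ∈ S.RS k,
    (∀ (c : Channel P) (a : A) (x : List A), s.queue c = a :: x →
      ∃ φ t t', S.BExec k s φ t ∧ S.BExec k t [Action.recv c a] t') ∧
    (∀ p, (S p).IsReceiving (s.state p) →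
      ∃ (c : Channel P) (a : A) (φ : List (Action P A)) (t t' : S.Config),
        c.tgt = p ∧ S.BExec k s φ t ∧ S.BExec k t [Action.recv c a] t')

def IsExhaustive (k : ℕ) : Prop :=
  ∀ s ∈ S.RS k, ∀ p, (S p).IsSending (s.state p) →
    ∀ l q', (s.state p, l, q') ∈ (S p).δ →
      ∃ φ t t', S.BExec k s φ t ∧ S.BExec k t [l] t' ∧ NotIn p φ

/-- `k`-multiparty compatibility. -/
def IsMC (k : ℕ) : Prop := S.IsSafe k ∧ S.IsExhaustive k

/-- The configurations of the synchronous transition system: those reached by a synchronous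
execution, or by a synchronous execution followed by one send. -/
def RSZero : Set S.Config :=
  {s | ∃ φ, S.BExec 1 S.initial φ s ∧ IsSync φ} ∪
  {s | ∃ φ c a, S.BExec 1 S.initial (φ ++ [Action.send c a]) s ∧ IsSync φ}

/-- The transitions of the synchronous transition system: the two halves `s → s'` (send) and
`s' → s''` (receive) of an exchange `s → s' → s''` between configurations of `RSZero`. -/
def SyncStep (s : S.Config) : Action P A → S.Config → Prop
  | .send c a, s' =>
      s ∈ S.RSZero ∧ s' ∈ S.RSZero ∧ ∃ s'' ∈ S.RSZero,
        S.BExec 1 s [Action.send c a] s' ∧ S.BExec 1 s' [Action.recv c a] s''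
  | .recv c a, s'' =>
      s ∈ S.RSZero ∧ s'' ∈ S.RSZero ∧ ∃ r ∈ S.RSZero,
        S.BExec 1 r [Action.send c a] s ∧ S.BExec 1 s [Action.recv c a] s''

/-- Paths of the synchronous transition system. -/
def SyncExec : S.Config → List (Action P A) → S.Config → Prop
  | s, [], s' => s' = s
  | s, l :: φ, s' => ∃ t, S.SyncStep s l t ∧ SyncExec t φ s'

/-- Synchronous multiparty compatibility. -/
def IsSMC : Prop :=
  ∀ p, ∀ s ∈ S.RSZero, s.IsStable →
    ((S p).IsSending (s.state p) →
      ∀ l q', (s.state p, l, q') ∈ (S p).δ →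
        ∃ φ t, IsSync φ ∧ S.SyncExec s φ t ∧ proj p φ = [l]) ∧
    ((S p).IsReceiving (s.state p) →
      ∃ l q', (s.state p, l, q') ∈ (S p).δ ∧
        ∃ φ t, IsSync φ ∧ S.SyncExec s φ t ∧ proj p φ = [l])

end System

end CommAut

namespace CommAut

namespace Action

variable {P : Type u} {A : Type v}

/-- The channel an action operates on. -/
def chan : Action P A → Channel P
  | send c _ => c
  | recv c _ => c

end Action

/-! ### Words of actions and their projections -/

theorem notIn_nil {P : Type u} {A : Type v} (p : P) : NotIn p ([] : List (Action P A)) := by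
  simp [NotIn]

theorem notIn_cons {P : Type u} {A : Type v} {p : P} {l : Action P A} {φ : List (Action P A)} :
    NotIn p (l :: φ) ↔ l.subj ≠ p ∧ NotIn p φ := by
  simp [NotIn]

theorem notIn_append {P : Type u} {A : Type v} {p : P} {φ ψ : List (Action P A)} :
    NotIn p (φ ++ ψ) ↔ NotIn p φ ∧ NotIn p ψ := by
  simp [NotIn, or_imp, forall_and]

theorem proj_cons_of_eq {P : Type u} {A : Type v} {p : P} {l : Action P A}
    {φ : List (Action P A)} (h : l.subj = p) : proj p (l :: φ) = l :: proj p φ := by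
  simp [proj, h]

theorem proj_cons_of_ne {P : Type u} {A : Type v} {p : P} {l : Action P A}
    {φ : List (Action P A)} (h : l.subj ≠ p) : proj p (l :: φ) = proj p φ := by
  simp [proj, h]

theorem mem_of_proj_eq_singleton {P : Type u} {A : Type v} {p : P} {l : Action P A}
    {φ : List (Action P A)} (h : proj p φ = [l]) : l ∈ φ := by
  have : l ∈ proj p φ := by simp [h]
  exact List.mem_of_mem_filter this

theorem IsSync.append {P : Type u} {A : Type v} {φ ψ : List (Action P A)}
    (h : IsSync φ) (h' : IsSync ψ) : IsSync (φ ++ ψ) := by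
  induction h with
  | nil => exact h'
  | cons c a φ _ ih => exact .cons c a _ ih

/-! ### Actions on queues -/

/-- The effect of an action on the queues. -/
def QueueStep {P : Type u} {A : Type v} (w : Channel P → List A) :
    Action P A → (Channel P → List A) → Prop
  | .send c a, w' => w' c = w c ++ [a] ∧ ∀ d, d ≠ c → w' d = w d
  | .recv c a, w' => w c = a :: w' c ∧ ∀ d, d ≠ c → w' d = w d

namespace QueueStep

variable {P : Type u} {A : Type v} {w w₁ w₂ : Channel P → List A} {l l' : Action P A}

theorem eq_of_ne (h : QueueStep w l w₁) {d : Channel P} (hd : d ≠ l.chan) : w₁ d = w d := by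
  cases l <;> exact h.2 d hd

theorem unique (h : QueueStep w l w₁) (h' : QueueStep w l w₂) : w₁ = w₂ := by
  funext d
  by_cases hd : d = l.chan
  · subst hd
    cases l with
    | send c a => exact h.1.trans h'.1.symm
    | recv c a => exact (List.cons.inj (h.1.symm.trans h'.1)).2
  · rw [h.eq_of_ne hd, h'.eq_of_ne hd]

theorem exists_send (w : Channel P → List A) (c : Channel P) (a : A) :
    ∃ w', QueueStep w (.send c a) w' := by
  classical
  refine ⟨Function.update w c (w c ++ [a]), by simp, fun d hd => by simp [hd]⟩

theorem exists_recv {c : Channel P} {a : A} {x : List A} (h : w c = a :: x) :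
    ∃ w', QueueStep w (.recv c a) w' ∧ w' c = x := by
  classical
  refine ⟨Function.update w c x, ⟨by simp [h], fun d hd => by simp [hd]⟩, by simp⟩

theorem exists_of_ne_chan (h : QueueStep w l w₁) (h' : QueueStep w l' w₂)
    (hne : l.chan ≠ l'.chan) : ∃ w₃, QueueStep w₁ l' w₃ := by
  have e : w₁ l'.chan = w l'.chan := h.eq_of_ne hne.symm
  cases l' with
  | send c a => exact exists_send _ _ _
  | recv c a =>
    obtain ⟨w₃, hw, -⟩ := exists_recv (e.trans h'.1)
    exact ⟨w₃, hw⟩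

/-- Actions of different participants commute on queues. -/
theorem diamond (h : QueueStep w l w₁) (h' : QueueStep w l' w₂) (hne : l.subj ≠ l'.subj) :
    ∃ w₃, QueueStep w₁ l' w₃ ∧ QueueStep w₂ l w₃ := by
  classical
  by_cases hc : l.chan = l'.chan
  -- On a common channel, different subjects mean one send and one receive. The receive is already
  -- enabled, so the queue is nonempty and the two actions work on opposite ends of it.
  · cases l with
    | send c a =>
      cases l' with
      | send d b => obtain rfl : c = d := hc; exact absurd rfl hne
      | recv d b =>
        obtain rfl : c = d := hc
        refine ⟨Function.update w c (w₂ c ++ [a]), ⟨?_, ?_⟩, ⟨by simp, ?_⟩⟩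
        · simp [h.1, h'.1]
        · intro d hd; simp [hd, h.2 d hd]
        · intro d hd; simp [hd, h'.2 d hd]
    | recv c a =>
      cases l' with
      | recv d b => obtain rfl : c = d := hc; exact absurd rfl hne
      | send d b =>
        obtain rfl : c = d := hc
        refine ⟨Function.update w c (w₁ c ++ [b]), ⟨by simp, ?_⟩, ⟨?_, ?_⟩⟩
        · intro d hd; simp [hd, h.2 d hd]
        · simp [h.1, h'.1]
        · intro d hd; simp [hd, h'.2 d hd]
  · obtain ⟨w₃, h₃⟩ := h.exists_of_ne_chan h' hc
    obtain ⟨w₄, h₄⟩ := h'.exists_of_ne_chan h (Ne.symm hc)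
    have : w₃ = w₄ := by
      funext d
      by_cases h1 : d = l.chan
      · subst h1
        rw [h₃.eq_of_ne hc]
        have e := h'.eq_of_ne hc
        cases l with
        | send c a =>
          change w₁ c = w₄ c
          rw [h₄.1, h.1, show w₂ c = w c from e]
        | recv c a =>
          have e1 := h.1
          have e2 := h₄.1
          rw [show w₂ c = w c from e, e1] at e2
          exact (List.cons.inj e2).2
      · rw [h₄.eq_of_ne h1]
        by_cases h2 : d = l'.chan
        · subst h2
          have e := h.eq_of_ne h1
          cases l' with
          | send c a =>
            change w₃ c = w₂ c
            rw [h₃.1, h'.1, show w₁ c = w c from e]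
          | recv c a =>
            have e1 := h'.1
            have e2 := h₃.1
            rw [show w₁ c = w c from e, e1] at e2
            exact (List.cons.inj e2).2.symm
        · rw [h₃.eq_of_ne h2, h.eq_of_ne h1, h'.eq_of_ne h2]
    exact ⟨w₃, h₃, this ▸ h₄⟩

end QueueStep

namespace System

variable {P : Type u} {A : Type v} {S : System.{u, v, w} P A}

/-! ### Commutation of single steps -/

section Steps

variable {s s₁ s₂ t : S.Config} {l l' : Action P A} {k : ℕ}

theorem step_iff : S.Step s l t ↔ (s.state l.subj, l, t.state l.subj) ∈ (S l.subj).δ ∧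
    (∀ p, p ≠ l.subj → t.state p = s.state p) ∧ QueueStep s.queue l t.queue := by
  cases l <;> rfl

theorem Step.mem_δ (h : S.Step s l t) : (s.state l.subj, l, t.state l.subj) ∈ (S l.subj).δ :=
  (step_iff.1 h).1

theorem Step.state_eq (h : S.Step s l t) {p : P} (hp : l.subj ≠ p) : t.state p = s.state p :=
  (step_iff.1 h).2.1 p hp.symm

theorem Step.queueStep (h : S.Step s l t) : QueueStep s.queue l t.queue :=
  (step_iff.1 h).2.2

theorem exists_step {q' : (S l.subj).State} (h : (s.state l.subj, l, q') ∈ (S l.subj).δ)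
    {w' : Channel P → List A} (hw : QueueStep s.queue l w') :
    ∃ t, S.Step s l t ∧ t.queue = w' := by
  classical
  refine ⟨⟨Function.update s.state l.subj q', w'⟩, step_iff.2 ⟨by simpa using h, ?_, hw⟩, rfl⟩
  intro p hp
  simp [hp]

theorem Step.unique (hS : S.IsCSA) (h : S.Step s l s₁) (h' : S.Step s l s₂) : s₁ = s₂ := by
  refine Config.ext ?_ (h.queueStep.unique h'.queueStep)
  funext p
  by_cases hp : l.subj = p
  · subst hp
    exact (hS _).2.1 _ _ _ _ _ h.mem_δ h'.mem_δ rfl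
  · rw [h.state_eq hp, h'.state_eq hp]

/-- Actions of different participants commute. -/
theorem Step.diamond (h : S.Step s l s₁) (h' : S.Step s l' s₂) (hne : l.subj ≠ l'.subj) :
    ∃ t, S.Step s₁ l' t ∧ S.Step s₂ l t := by
  classical
  obtain ⟨w, hw, hw'⟩ := h.queueStep.diamond h'.queueStep hne
  refine ⟨⟨Function.update s₁.state l'.subj (s₂.state l'.subj), w⟩,
    step_iff.2 ⟨?_, ?_, hw⟩, step_iff.2 ⟨?_, ?_, hw'⟩⟩
  · simpa [h.state_eq hne] using h'.mem_δ
  · intro p hp; simp [hp]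
  · simpa [h'.state_eq hne.symm, Function.update_of_ne hne] using h.mem_δ
  · intro p hp
    by_cases hp' : p = l'.subj
    · subst hp'; simp
    · simp [hp', h.state_eq hp.symm, h'.state_eq (Ne.symm hp')]

/-- A send can be moved before an action of another participant. -/
theorem Step.swap_send (hS : S.IsCSA) {c : Channel P} {a : A} (h : S.Step s l s₁)
    (h' : S.Step s₁ (.send c a) t) (hne : l.subj ≠ c.src) :
    ∃ s₂, S.Step s (.send c a) s₂ ∧ S.Step s₂ l t := by
  obtain ⟨w', hw'⟩ := QueueStep.exists_send s.queue c a
  have hm := h'.mem_δ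
  rw [h.state_eq (p := (Action.send c a).subj) hne] at hm
  obtain ⟨s₂, h₂, -⟩ := exists_step hm hw'
  obtain ⟨t', ht', ht⟩ := h.diamond h₂ hne
  rw [h'.unique hS ht']
  exact ⟨s₂, h₂, ht⟩

/-- Without mixed states one send makes the state sending; directedness then fixes the reader and
the subject fixes the writer, so only the message remains free. -/
theorem send_of_send (hS : S.IsCSA) (hD : S.IsDirected) {p : P} {q q₁ q₂ : (S p).State}
    {c : Channel P} {a : A} (h : (q, .send c a, q₁) ∈ (S p).δ) (h' : (q, l, q₂) ∈ (S p).δ) :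
    ∃ b, l = .send c b := by
  have hs : (S p).IsSending q := by
    by_contra hs
    refine (hS p).2.2 q ⟨fun hf => hf _ _ h, hs, fun hr => ?_⟩
    exact hr.2 _ _ h
  have ho := (hD p).1 _ _ _ _ _ hs h h'
  have h1 := (hS p).1 _ _ _ h
  have h2 := (hS p).1 _ _ _ h'
  have h3 := hs.2 _ _ h'
  cases l with
  | send d b => exact ⟨b, by rw [show d = c from Subtype.ext (Prod.ext (h2.trans h1.symm) ho.symm)]⟩
  | recv d b => exact h3.elim

theorem recv_of_recv (hS : S.IsCSA) (hD : S.IsDirected) {p : P} {q q₁ q₂ : (S p).State}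
    {c : Channel P} {a : A} (h : (q, .recv c a, q₁) ∈ (S p).δ) (h' : (q, l, q₂) ∈ (S p).δ) :
    ∃ b, l = .recv c b := by
  have hs : (S p).IsReceiving q := by
    by_contra hs
    refine (hS p).2.2 q ⟨fun hf => hf _ _ h, fun hr => ?_, hs⟩
    exact hr.2 _ _ h
  have ho := (hD p).2 _ _ _ _ _ hs h h'
  have h1 := (hS p).1 _ _ _ h
  have h2 := (hS p).1 _ _ _ h'
  have h3 := hs.2 _ _ h'
  cases l with
  | recv d b => exact ⟨b, by rw [show d = c from Subtype.ext (Prod.ext ho.symm (h2.trans h1.symm))]⟩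
  | send d b => exact h3.elim

/-- An enabled receive stays enabled until it is executed. -/
theorem Step.recv_diamond (hS : S.IsCSA) (hD : S.IsDirected) {c : Channel P} {a : A}
    (h : S.Step s (.recv c a) s₁) (h' : S.Step s l s₂) :
    s₂ = s₁ ∨ ∃ t, S.Step s₁ l t ∧ S.Step s₂ (.recv c a) t := by
  by_cases hne : (Action.recv c a).subj = l.subj
  · have h1 := h.mem_δ
    rw [hne] at h1
    obtain ⟨b, rfl⟩ := recv_of_recv hS hD h1 h'.mem_δ
    -- Both receives read the head of the same queue, so the messages agree, and determinism does
    -- the rest.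
    have e := h.queueStep.1.symm.trans h'.queueStep.1
    obtain rfl : a = b := (List.cons.inj e).1
    exact .inl (h'.unique hS h)
  · exact .inr (h.diamond h' hne)

theorem Config.IsStable.isBounded (h : s.IsStable) (k : ℕ) : s.IsBounded k := by
  intro c; simp [h c]

theorem Config.IsBounded.mono {k k' : ℕ} (h : s.IsBounded k) (hk : k ≤ k') : s.IsBounded k' :=
  fun c => (h c).trans hk

theorem Step.isBounded_recv {c : Channel P} {a : A} (h : S.Step s (.recv c a) t)
    (hs : s.IsBounded k) : t.IsBounded k := by
  intro d
  by_cases hd : d = c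
  · subst hd
    have := hs d
    rw [h.queueStep.1] at this
    simp at this; omega
  · rw [h.queueStep.2 d hd]; exact hs d

theorem Step.isBounded_send {c : Channel P} {a : A} (h : S.Step s (.send c a) t)
    (hs : s.IsBounded k) (hc : s.queue c = []) (hk : 1 ≤ k) : t.IsBounded k := by
  intro d
  by_cases hd : d = c
  · subst hd
    rw [h.queueStep.1, hc]; simpa using hk
  · rw [h.queueStep.2 d hd]; exact hs d

/-- Only `c.src` writes to `c`. Hence an empty channel stays empty while its writer is idle, which
keeps executions within the bound when a send is moved across them. -/
theorem Step.queue_eq_nil {c : Channel P} (h : S.Step s l t) (hl : l.subj ≠ c.src)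
    (hc : s.queue c = []) : t.queue c = [] := by
  by_cases hd : c = l.chan
  · cases l with
    | send d b => obtain rfl : c = d := hd; exact absurd rfl hl
    | recv d b =>
      obtain rfl : c = d := hd
      have := h.queueStep.1
      simp [hc] at this
  · rw [h.queueStep.eq_of_ne hd, hc]

end Steps

/-! ### Rearranging bounded executions -/

section Executions

variable {s s₁ t t' : S.Config} {l : Action P A} {φ ψ : List (Action P A)} {k : ℕ}

theorem BExec.isBounded_left (h : S.BExec k s φ t) : s.IsBounded k := by
  cases φ <;> exact h.1

theorem BExec.isBounded_right (h : S.BExec k s φ t) : t.IsBounded k := by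
  induction φ generalizing s with
  | nil => obtain ⟨h, rfl⟩ := h; exact h
  | cons l φ ih => obtain ⟨-, r, -, h⟩ := h; exact ih h

theorem BExec.append (h : S.BExec k s φ t) (h' : S.BExec k t ψ t') :
    S.BExec k s (φ ++ ψ) t' := by
  induction φ generalizing s with
  | nil => obtain ⟨-, rfl⟩ := h; exact h'
  | cons l φ ih => obtain ⟨hb, r, hr, h⟩ := h; exact ⟨hb, r, hr, ih h⟩

theorem bexec_append : S.BExec k s (φ ++ ψ) t' ↔ ∃ t, S.BExec k s φ t ∧ S.BExec k t ψ t' := by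
  refine ⟨fun h => ?_, fun ⟨t, h, h'⟩ => h.append h'⟩
  induction φ generalizing s with
  | nil => exact ⟨s, ⟨h.isBounded_left, rfl⟩, h⟩
  | cons l φ ih =>
    obtain ⟨hb, r, hr, h⟩ := h
    obtain ⟨t, h1, h2⟩ := ih h
    exact ⟨t, ⟨hb, r, hr, h1⟩, h2⟩

theorem bexec_singleton :
    S.BExec k s [l] t ↔ s.IsBounded k ∧ t.IsBounded k ∧ S.Step s l t := by
  constructor
  · rintro ⟨hb, r, hr, hb', rfl⟩
    exact ⟨hb, hb', hr⟩
  · rintro ⟨hb, hb', hr⟩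
    exact ⟨hb, t, hr, hb', rfl⟩

theorem BExec.mono {k k' : ℕ} (h : S.BExec k s φ t) (hk : k ≤ k') : S.BExec k' s φ t := by
  induction φ generalizing s with
  | nil => exact ⟨h.1.mono hk, h.2⟩
  | cons l φ ih => obtain ⟨hb, r, hr, h⟩ := h; exact ⟨hb.mono hk, r, hr, ih h⟩

theorem BExec.state_eq (h : S.BExec k s φ t) {p : P} (hp : NotIn p φ) :
    t.state p = s.state p := by
  induction φ generalizing s with
  | nil => obtain ⟨-, rfl⟩ := h; rfl
  | cons l φ ih =>
    obtain ⟨-, r, hr, h⟩ := h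
    rw [notIn_cons] at hp
    rw [ih h hp.2, hr.state_eq hp.1]

/-- The first action of `p` in an execution. -/
theorem BExec.exists_first (h : S.BExec k s φ t) {p : P} (hp : ¬ NotIn p φ) :
    ∃ φ₁ l r r', S.BExec k s φ₁ r ∧ NotIn p φ₁ ∧ l.subj = p ∧ S.BExec k r [l] r' := by
  induction φ generalizing s with
  | nil => exact absurd (notIn_nil p) hp
  | cons l φ ih =>
    obtain ⟨hb, r, hr, h⟩ := h
    by_cases hl : l.subj = p
    · exact ⟨[], l, s, r, ⟨hb, rfl⟩, notIn_nil p, hl,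
        bexec_singleton.2 ⟨hb, h.isBounded_left, hr⟩⟩
    · obtain ⟨φ₁, l', r₁, r₂, h1, h2, h3, h4⟩ := ih h fun hn => hp (notIn_cons.2 ⟨hl, hn⟩)
      exact ⟨l :: φ₁, l', r₁, r₂, ⟨hb, r, hr, h1⟩, notIn_cons.2 ⟨hl, h2⟩, h3, h4⟩

/-- A message that disappears from the head of its queue has been received. -/
theorem BExec.exists_recv (h : S.BExec k s φ t) {c : Channel P} {a : A} {x : List A}
    (hs : s.queue c = a :: x) (ht : t.queue c = []) :
    ∃ φ₁ r r', S.BExec k s φ₁ r ∧ S.BExec k r [.recv c a] r' := by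
  induction φ generalizing s x with
  | nil => obtain ⟨-, rfl⟩ := h; simp [hs] at ht
  | cons l φ ih =>
    obtain ⟨hb, r, hr, h⟩ := h
    have key : l = .recv c a ∨ ∃ y, r.queue c = a :: y := by
      by_cases hc : c = l.chan
      · cases l with
        | send d b =>
          obtain rfl : c = d := hc
          exact .inr ⟨x ++ [b], by rw [hr.queueStep.1, hs]; rfl⟩
        | recv d b =>
          obtain rfl : c = d := hc
          have := hr.queueStep.1
          rw [hs] at this
          exact .inl (by rw [(List.cons.inj this).1])
      · exact .inr ⟨x, by rw [hr.queueStep.eq_of_ne hc, hs]⟩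
    rcases key with rfl | ⟨y, hy⟩
    · exact ⟨[], s, r, ⟨hb, rfl⟩, bexec_singleton.2 ⟨hb, h.isBounded_left, hr⟩⟩
    · obtain ⟨φ₁, r₁, r₂, h1, h2⟩ := ih h hy
      exact ⟨l :: φ₁, r₁, r₂, ⟨hb, r, hr, h1⟩, h2⟩

/-- An enabled receive is either executed within an execution, which becomes shorter when it is
executed first, or is still enabled at its end. -/
theorem BExec.recv_push (hS : S.IsCSA) (hD : S.IsDirected) {c : Channel P} {a : A}
    (h : S.BExec k s φ t) (h₁ : S.Step s (.recv c a) s₁) :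
    (∃ φ', φ'.length < φ.length ∧ S.BExec k s₁ φ' t) ∨
      ∃ t₁, S.Step t (.recv c a) t₁ ∧ S.BExec k s₁ φ t₁ := by
  induction φ generalizing s s₁ with
  | nil =>
    obtain ⟨hb, rfl⟩ := h
    exact .inr ⟨s₁, h₁, h₁.isBounded_recv hb, rfl⟩
  | cons l φ ih =>
    obtain ⟨hb, r, hr, h⟩ := h
    have hb₁ := h₁.isBounded_recv hb
    rcases h₁.recv_diamond hS hD hr with rfl | ⟨r₁, hr₁, hr₂⟩
    · exact .inl ⟨φ, by simp, h⟩
    · rcases ih h hr₂ with ⟨φ', hl, h'⟩ | ⟨t₁, ht₁, h'⟩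
      · exact .inl ⟨l :: φ', by simpa using hl, hb₁, r₁, hr₁, h'⟩
      · exact .inr ⟨t₁, ht₁, hb₁, r₁, hr₁, h'⟩

/-- A send on an empty channel commutes with executions in which the sender is idle. -/
theorem BExec.send_push (hk : 1 ≤ k) {c : Channel P} {a : A}
    (h : S.BExec k s φ t) (h₁ : S.Step s (.send c a) s₁) (hφ : NotIn c.src φ)
    (hc : s.queue c = []) : ∃ t₁, S.Step t (.send c a) t₁ ∧ S.BExec k s₁ φ t₁ := by
  induction φ generalizing s s₁ with
  | nil =>
    obtain ⟨hb, rfl⟩ := h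
    exact ⟨s₁, h₁, h₁.isBounded_send hb hc hk, rfl⟩
  | cons l φ ih =>
    obtain ⟨hb, r, hr, h⟩ := h
    rw [notIn_cons] at hφ
    obtain ⟨r₁, hr₁, hr₂⟩ := h₁.diamond hr hφ.1.symm
    obtain ⟨t₁, ht₁, h'⟩ := ih h hr₂ hφ.2 (hr.queue_eq_nil hφ.1 hc)
    exact ⟨t₁, ht₁, h₁.isBounded_send hb hc hk, r₁, hr₁, h'⟩

/-- The first action of a participant that can only send on an empty channel may be executed
first. -/
theorem BExec.send_pull (hS : S.IsCSA) (hD : S.IsDirected) (hk : 1 ≤ k) {c : Channel P}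
    {a : A} {q' : (S c.src).State} (h : S.BExec k s φ t)
    (hq : (s.state c.src, .send c a, q') ∈ (S c.src).δ) (hφ : ¬ NotIn c.src φ)
    (hc : s.queue c = []) :
    ∃ b s₁ φ', S.Step s (.send c b) s₁ ∧ S.BExec k s₁ φ' t ∧ φ'.length < φ.length := by
  induction φ generalizing s with
  | nil => exact absurd (notIn_nil _) hφ
  | cons l φ ih =>
    obtain ⟨hb, r, hr, h⟩ := h
    by_cases hl : l.subj = c.src
    · have hm := hr.mem_δ
      rw [hl] at hm
      obtain ⟨b, rfl⟩ := send_of_send hS hD hq hm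
      exact ⟨b, r, φ, hr, h, by simp⟩
    · rw [← hr.state_eq hl] at hq
      obtain ⟨b, r₁, φ', hr₁, h', hlen⟩ :=
        ih h hq (fun hn => hφ (notIn_cons.2 ⟨hl, hn⟩)) (hr.queue_eq_nil hl hc)
      obtain ⟨s₁, hs₁, hs₂⟩ := hr.swap_send hS hr₁ hl
      exact ⟨b, s₁, l :: φ', hs₁, ⟨hs₁.isBounded_send hb hc hk, r₁, hs₂, h'⟩, by simpa using hlen⟩

end Executions

/-! ### From SMC to multiparty compatibility -/

section Synchronous

variable {s s₁ s₂ t : S.Config} {φ : List (Action P A)} {k : ℕ}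

theorem SyncStep.bexec {l : Action P A} (h : S.SyncStep s l t) : S.BExec 1 s [l] t := by
  cases l with
  | send c a => obtain ⟨-, -, -, -, h, -⟩ := h; exact h
  | recv c a => obtain ⟨-, -, -, -, -, h⟩ := h; exact h

theorem SyncStep.step {l : Action P A} (h : S.SyncStep s l t) : S.Step s l t :=
  (bexec_singleton.1 h.bexec).2.2

theorem SyncExec.bexec (h : S.SyncExec s φ t) (hs : s.IsBounded 1) : S.BExec 1 s φ t := by
  induction φ generalizing s with
  | nil => exact ⟨hs, h⟩
  | cons l φ ih =>
    obtain ⟨r, hr, h⟩ := h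
    exact ⟨hs, r, hr.step, ih h (bexec_singleton.1 hr.bexec).2.1⟩

theorem IsStable.exchange {c : Channel P} {a : A} (hs : s.IsStable)
    (h₁ : S.Step s (.send c a) s₁) (h₂ : S.Step s₁ (.recv c a) s₂) : s₂.IsStable := by
  intro d
  by_cases hd : d = c
  · subst hd
    have := h₂.queueStep.1
    rw [h₁.queueStep.1, hs d] at this
    simpa using this.symm
  · rw [h₂.queueStep.2 d hd, h₁.queueStep.2 d hd, hs d]

variable (S) in
/-- The stable configurations of the synchronous transition system. -/
def StableReach : Set S.Config := {s | s ∈ S.RSZero ∧ s.IsStable}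

theorem initial_mem_stableReach : S.initial ∈ S.StableReach :=
  ⟨.inl ⟨[], ⟨fun _ => Nat.zero_le _, rfl⟩, .nil⟩, fun _ => rfl⟩

/-- An execution ending in an unmatched send leaves that message in its queue, so it cannot end in a
stable configuration. -/
theorem exists_isSync_of_mem_stableReach (h : s ∈ S.StableReach) :
    ∃ φ, S.BExec 1 S.initial φ s ∧ IsSync φ := by
  rcases h.1 with h' | ⟨φ, c, a, h', -⟩
  · exact h'
  · obtain ⟨r, -, hr⟩ := bexec_append.1 h'
    have := (bexec_singleton.1 hr).2.2.queueStep.1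
    simp [h.2 c] at this

theorem stableReach_exchange {c : Channel P} {a : A} (hs : s ∈ S.StableReach)
    (h₁ : S.Step s (.send c a) s₁) (h₂ : S.Step s₁ (.recv c a) s₂) : s₂ ∈ S.StableReach := by
  have hb := hs.2.isBounded 1
  have hb₁ := h₁.isBounded_send hb (hs.2 c) le_rfl
  obtain ⟨φ, hφ, hsync⟩ := exists_isSync_of_mem_stableReach hs
  refine ⟨.inl ⟨φ ++ [.send c a, .recv c a], hφ.append ?_, hsync.append (.cons c a _ .nil)⟩,
    IsStable.exchange hs.2 h₁ h₂⟩
  exact ⟨hb, s₁, h₁, hb₁, s₂, h₂, h₂.isBounded_recv hb₁, rfl⟩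

/-- A participant that waits for messages of `c.src` can receive whatever `c.src` sends first. -/
theorem exists_recv_of_syncExec (hS : S.IsCSA) (hD : S.IsDirected) {c : Channel P} {a b : A}
    (hφ : IsSync φ) (h : S.SyncExec s φ t) {q : (S c.tgt).State}
    (hq : (s.state c.tgt, .recv c a, q) ∈ (S c.tgt).δ) (hp : proj c.src φ = [.send c b]) :
    ∃ q', (s.state c.tgt, .recv c b, q') ∈ (S c.tgt).δ := by
  induction hφ generalizing s with
  | nil => simp [proj] at hp
  | cons d m φ _ ih =>
    obtain ⟨s₁, h₁, s₂, h₂, h⟩ := h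
    replace h₁ := h₁.step
    replace h₂ := h₂.step
    by_cases hd : d.src = c.src
    · rw [proj_cons_of_eq (l := .send d m) hd] at hp
      obtain ⟨rfl, rfl⟩ := Action.send.inj (List.cons.inj hp).1
      have hm := h₂.mem_δ
      rw [h₁.state_eq (p := (Action.recv d m).subj) d.2] at hm
      exact ⟨_, hm⟩
    · rw [proj_cons_of_ne (l := .send d m) hd] at hp
      have hd' : d.tgt ≠ c.src := by
        intro e
        rw [proj_cons_of_eq (l := .recv d m) e] at hp
        simp at hp
      rw [proj_cons_of_ne (l := .recv d m) hd'] at hp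
      -- The reader `c.tgt` stays put until `c.src` acts: it cannot send, and by directedness it can
      -- receive from `c.src` only.
      have e₁ : d.src ≠ c.tgt := by
        intro e
        have hm := h₁.mem_δ
        rw [show (Action.send d m).subj = c.tgt from e] at hm
        obtain ⟨_, hb⟩ := recv_of_recv hS hD hq hm
        cases hb
      have e₂ : d.tgt ≠ c.tgt := by
        intro e
        have hm := h₂.mem_δ
        rw [show (Action.recv d m).subj = c.tgt from e, h₁.state_eq e₁] at hm
        obtain ⟨_, hb⟩ := recv_of_recv hS hD hq hm
        exact hd (by rw [(Action.recv.inj hb).1])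
      have e : s₂.state c.tgt = s.state c.tgt := by
        rw [h₂.state_eq (l := .recv d m) e₂, h₁.state_eq (l := .send d m) e₁]
      rw [← e] at hq ⊢
      exact ih h hq hp

/-- If an exchange on `c` is possible in a stable configuration, then every message that
`c.src` can send can be exchanged. -/
theorem IsSMC.exists_recv (hS : S.IsCSA) (hD : S.IsDirected) (hM : S.IsSMC)
    {c : Channel P} {a b : A} (hs : s ∈ S.StableReach) {q : (S c.src).State}
    {q' : (S c.tgt).State} (hq : (s.state c.src, .send c b, q) ∈ (S c.src).δ)
    (hq' : (s.state c.tgt, .recv c a, q') ∈ (S c.tgt).δ) :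
    ∃ q', (s.state c.tgt, .recv c b, q') ∈ (S c.tgt).δ := by
  have hsend : (S c.src).IsSending (s.state c.src) := by
    refine ⟨fun hf => hf _ _ hq, fun l r hl => ?_⟩
    obtain ⟨_, rfl⟩ := send_of_send hS hD hq hl
    trivial
  obtain ⟨φ, t, hφ, h, hp⟩ := (hM _ s hs.1 hs.2).1 hsend _ _ hq
  exact exists_recv_of_syncExec hS hD hφ h hq' hp

/-- Every execution from a stable synchronously reachable configuration can be completed to one
that ends in such a configuration. -/
theorem IsSMC.exists_completion (hS : S.IsCSA) (hD : S.IsDirected) (hM : S.IsSMC) (hk : 1 ≤ k)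
    {α : List (Action P A)} (hs : s ∈ S.StableReach) (hα : S.BExec k s α t) :
    ∃ χ t', S.BExec k t χ t' ∧ t' ∈ S.StableReach := by
  induction hn : α.length using Nat.strong_induction_on generalizing α s t with
  | _ n IH =>
  subst hn
  -- The word `α` is fixed while its endpoints move. The last premise, a sender of `θ` that acts in
  -- `α`, rules out that `θ` is used up before `α` gets shorter.
  have inner : ∀ θ : List (Action P A), IsSync θ → ∀ s t r : S.Config, s ∈ S.StableReach →
      S.SyncExec s θ r → S.BExec k s α t → (∃ c a, .send c a ∈ θ ∧ ¬ NotIn c.src α) →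
      ∃ χ t', S.BExec k t χ t' ∧ t' ∈ S.StableReach := by
    intro θ hθ
    induction hθ with
    | nil => rintro s t r - - - ⟨c, a, h, -⟩; simp at h
    | cons c m θ _ ih =>
      rintro s t r hs ⟨s₁, h₁, s₂, h₂, hr⟩ hα hx
      replace h₁ := h₁.step
      replace h₂ := h₂.step
      by_cases hc : NotIn c.src α
      · obtain ⟨t₁, ht₁, hα₁⟩ := hα.send_push hk h₁ hc (hs.2 c)
        have hs₂ := stableReach_exchange hs h₁ h₂
        rcases hα₁.recv_push hS hD h₂ with ⟨α', hlen, hα'⟩ | ⟨t₂, ht₂, hα'⟩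
        · obtain ⟨χ, t', hχ, ht'⟩ := IH _ hlen hs₂ hα' rfl
          exact ⟨_ :: χ, t', ⟨hα.isBounded_right, t₁, ht₁, hχ⟩, ht'⟩
        -- The exchange just played had a sender idle in `α`, so the sender that acts in `α` still
        -- occurs in the rest of `θ`.
        · have hx' : ∃ c a, Action.send c a ∈ θ ∧ ¬ NotIn c.src α := by
            obtain ⟨d, a, hd, hd'⟩ := hx
            refine ⟨d, a, ?_, hd'⟩
            simp only [List.mem_cons, Action.send.injEq, reduceCtorEq, false_or] at hd
            rcases hd with ⟨rfl, -⟩ | hd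
            · exact absurd hc hd'
            · exact hd
          obtain ⟨χ, t', hχ, ht'⟩ := ih s₂ t₂ r hs₂ hr hα' hx'
          exact ⟨_ :: _ :: χ, t',
            ⟨hα.isBounded_right, t₁, ht₁, hα₁.isBounded_right, t₂, ht₂, hχ⟩, ht'⟩
      · obtain ⟨b, v, α', hv, hα', hlen⟩ := hα.send_pull hS hD hk h₁.mem_δ hc (hs.2 c)
        have hm := h₂.mem_δ
        rw [h₁.state_eq (p := (Action.recv c m).subj) c.2] at hm
        -- The pulled message `b` need not be the message `m` of `θ`: from here on `θ` is abandoned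
        -- and the exchange of `b` is played instead.
        obtain ⟨q', hq'⟩ := hM.exists_recv hS hD hs hv.mem_δ hm
        rw [← hv.state_eq (p := c.tgt) c.2] at hq'
        have hvq : v.queue c = b :: [] := by rw [hv.queueStep.1, hs.2 c]; rfl
        obtain ⟨w', hw', -⟩ := QueueStep.exists_recv hvq
        obtain ⟨v', hv', -⟩ := exists_step (l := .recv c b) hq' hw'
        have hs₂ := stableReach_exchange hs hv hv'
        -- In both cases the remaining word is shorter than `α`, since the pulled send has left it.
        rcases hα'.recv_push hS hD hv' with ⟨α'', hlen', hα''⟩ | ⟨t₂, ht₂, hα''⟩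
        · exact IH _ (hlen'.trans hlen) hs₂ hα'' rfl
        · obtain ⟨χ, t', hχ, ht'⟩ := IH _ hlen hs₂ hα'' rfl
          exact ⟨_ :: χ, t', ⟨hα.isBounded_right, t₂, ht₂, hχ⟩, ht'⟩
  cases α with
  | nil =>
    obtain ⟨hb, rfl⟩ := hα
    exact ⟨[], t, ⟨hb, rfl⟩, hs⟩
  | cons l α =>
    obtain ⟨r, hr, -⟩ := hα.2
    cases l with
    | recv c a =>
      have := hr.queueStep.1
      simp [hs.2 c] at this
    | send c a =>
      have hsend : (S c.src).IsSending (s.state c.src) := by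
        refine ⟨fun hf => hf _ _ hr.mem_δ, fun l r' hl => ?_⟩
        obtain ⟨_, rfl⟩ := send_of_send hS hD hr.mem_δ hl
        trivial
      obtain ⟨θ, r', hθ, h, hp⟩ := (hM _ s hs.1 hs.2).1 hsend _ _ hr.mem_δ
      exact inner θ hθ s t r' hs h hα ⟨c, a, mem_of_proj_eq_singleton hp,
        fun hn => (notIn_cons.1 hn).1 rfl⟩

/-- An execution whose projection on `p` is `l` starts with actions of the others, up to `l`. -/
theorem BExec.exists_first_of_proj {p : P} {l : Action P A} (h : S.BExec k s φ t)
    (hp : proj p φ = [l]) :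
    ∃ φ₁ r r', S.BExec k s φ₁ r ∧ NotIn p φ₁ ∧ S.BExec k r [l] r' := by
  induction φ generalizing s with
  | nil => simp [proj] at hp
  | cons l' φ ih =>
    obtain ⟨hb, r, hr, h⟩ := h
    by_cases hl : l'.subj = p
    · rw [proj_cons_of_eq hl] at hp
      obtain rfl := (List.cons.inj hp).1
      exact ⟨[], s, r, ⟨hb, rfl⟩, notIn_nil p, bexec_singleton.2 ⟨hb, h.isBounded_left, hr⟩⟩
    · rw [proj_cons_of_ne hl] at hp
      obtain ⟨φ₁, r₁, r₂, h1, h2, h3⟩ := ih h hp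
      exact ⟨l' :: φ₁, r₁, r₂, ⟨hb, r, hr, h1⟩, notIn_cons.2 ⟨hl, h2⟩, h3⟩

/-- The completion ends with empty queues, so each head message is read on the way. A receiving
participant that acts in the completion acts first from its present state, hence by a receive; one
that stays idle is served by SMC at the stable end. -/
theorem IsSMC.isSafe (hS : S.IsCSA) (hD : S.IsDirected) (hM : S.IsSMC) (hk : 1 ≤ k) :
    S.IsSafe k := by
  rintro s ⟨α, hα⟩
  obtain ⟨χ, t, hχ, ht⟩ := hM.exists_completion hS hD hk initial_mem_stableReach hα
  refine ⟨fun c a x hx => ?_, fun p hp => ?_⟩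
  · obtain ⟨φ, r, r', h⟩ := hχ.exists_recv hx (ht.2 c)
    exact ⟨φ, r, r', h⟩
  · have key : ∃ φ l r r', S.BExec k s φ r ∧ NotIn p φ ∧ l.subj = p ∧ S.BExec k r [l] r' := by
      by_cases hn : NotIn p χ
      · have hp' := hp
        rw [← hχ.state_eq hn] at hp'
        obtain ⟨l, q', hl, θ, r, -, hθ, hproj⟩ := (hM p t ht.1 ht.2).2 hp'
        obtain ⟨φ₁, r₁, r₂, h1, h2, h3⟩ :=
          ((hθ.bexec (ht.2.isBounded 1)).mono hk).exists_first_of_proj hproj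
        exact ⟨χ ++ φ₁, l, r₁, r₂, hχ.append h1, notIn_append.2 ⟨hn, h2⟩, (hS p).1 _ _ _ hl, h3⟩
      · exact hχ.exists_first hn
    obtain ⟨φ, l, r, r', h1, h2, rfl, h3⟩ := key
    have hm := (bexec_singleton.1 h3).2.2.mem_δ
    rw [h1.state_eq h2] at hm
    cases l with
    | send c a => exact (hp.2 _ _ hm).elim
    | recv c a => exact ⟨c, a, φ, r, r', rfl, h1, h3⟩

theorem IsSMC.isExhaustive (hS : S.IsCSA) (hD : S.IsDirected) (hM : S.IsSMC) (hk : 1 ≤ k) :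
    S.IsExhaustive k := by
  rintro s ⟨α, hα⟩ p hp l q' hl
  obtain ⟨χ, t, hχ, ht⟩ := hM.exists_completion hS hD hk initial_mem_stableReach hα
  by_cases hn : NotIn p χ
  · have e := hχ.state_eq hn
    rw [← e] at hp hl
    obtain ⟨θ, r, -, hθ, hproj⟩ := (hM p t ht.1 ht.2).1 hp l q' hl
    obtain ⟨φ₁, r₁, r₂, h1, h2, h3⟩ :=
      ((hθ.bexec (ht.2.isBounded 1)).mono hk).exists_first_of_proj hproj
    exact ⟨χ ++ φ₁, r₁, r₂, hχ.append h1, h3, notIn_append.2 ⟨hn, h2⟩⟩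
  · obtain ⟨φ, l', r, r', h1, h2, rfl, h3⟩ := hχ.exists_first hn
    obtain ⟨hb, hb', h3⟩ := bexec_singleton.1 h3
    rw [← h1.state_eq h2] at hl hp
    have hm := h3.mem_δ
    cases l' with
    | recv c a => exact (hp.2 _ _ hm).elim
    | send c a =>
      obtain ⟨b, rfl⟩ := send_of_send hS hD hm hl
      obtain ⟨w', hw'⟩ := QueueStep.exists_send r.queue c b
      obtain ⟨r'', hr'', -⟩ := exists_step (l := .send c b) hl hw'
      -- The completion may send another message `a` on `c`; sending `b` instead gives queues of the
      -- same lengths, so the bound carries over.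
      refine ⟨φ, r, r'', h1, bexec_singleton.2 ⟨hb, fun d => ?_, hr''⟩, h2⟩
      have := hb' d
      by_cases hd : d = c
      · subst hd
        rw [h3.queueStep.1] at this
        rw [hr''.queueStep.1]
        simpa using this
      · rw [h3.queueStep.2 d hd] at this
        rwa [hr''.queueStep.2 d hd]

theorem IsSMC.isMC (hS : S.IsCSA) (hD : S.IsDirected) (hM : S.IsSMC) (hk : 1 ≤ k) : S.IsMC k :=
  ⟨hM.isSafe hS hD hk, hM.isExhaustive hS hD hk⟩

end Synchronous

end System

/-! ### A system that is `k`-MC but not SMC -/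

/-- Two participants that send a message to each other before they receive one. -/
def crossing : System.{0, 0, 0} Bool Unit := fun p =>
  { State := Fin 3
    finite_state := inferInstance
    init := 0
    δ := {x | x.2.1.subj = p ∧
      ((x.1 = 0 ∧ x.2.1.IsSend ∧ x.2.2 = 1) ∨ (x.1 = 1 ∧ x.2.1.IsRecv ∧ x.2.2 = 2))} }

namespace crossing

variable {s t : crossing.Config}

/-- The local state of `p`. -/
def loc (s : crossing.Config) (p : Bool) : Fin 3 := s.state p

theorem mem_δ {p : Bool} {q q' : (crossing p).State} {l : Action Bool Unit} :
    (q, l, q') ∈ (crossing p).δ ↔ l.subj = p ∧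
      ((q = (0 : Fin 3) ∧ l.IsSend ∧ q' = (1 : Fin 3)) ∨
        (q = (1 : Fin 3) ∧ l.IsRecv ∧ q' = (2 : Fin 3))) :=
  Iff.rfl

theorem src_eq_or_tgt_eq (c : Channel Bool) (p : Bool) : p = c.src ∨ p = c.tgt := by
  obtain ⟨⟨x, y⟩, h⟩ := c
  revert h
  cases x <;> cases y <;> cases p <;> simp [Channel.src, Channel.tgt]

theorem channel_ne {c d : Channel Bool} (h : d ≠ c) : d.src = c.tgt ∧ d.tgt = c.src := by
  obtain ⟨⟨x, y⟩, hc⟩ := c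
  obtain ⟨⟨x', y'⟩, hd⟩ := d
  revert hc hd h
  cases x <;> cases y <;> cases x' <;> cases y' <;> simp [Channel.src, Channel.tgt]

/-- The channel from `p` to the other participant. -/
def chanFrom (p : Bool) : Channel Bool := ⟨(p, !p), by simp⟩

/-- The channel to `p` from the other participant. -/
def chanTo (p : Bool) : Channel Bool := ⟨(!p, p), by simp⟩

theorem step_send {c : Channel Bool} : crossing.Step s (.send c ()) t ↔
    loc s c.src = 0 ∧ loc t c.src = 1 ∧ loc t c.tgt = loc s c.tgt ∧
      QueueStep s.queue (.send c ()) t.queue := by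
  rw [System.step_iff, mem_δ]
  have hc : c.src ≠ c.tgt := c.2
  constructor
  · rintro ⟨⟨-, h⟩, h', h''⟩
    simp only [Action.IsSend, Action.IsRecv, true_and, false_and, and_false, or_false] at h
    exact ⟨h.1, h.2, h' _ hc.symm, h''⟩
  · rintro ⟨h1, h2, h3, h4⟩
    refine ⟨⟨rfl, .inl ⟨h1, trivial, h2⟩⟩, fun p hp => ?_, h4⟩
    obtain rfl := (src_eq_or_tgt_eq c p).resolve_left hp
    exact h3

theorem step_recv {c : Channel Bool} : crossing.Step s (.recv c ()) t ↔
    loc s c.tgt = 1 ∧ loc t c.tgt = 2 ∧ loc t c.src = loc s c.src ∧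
      QueueStep s.queue (.recv c ()) t.queue := by
  rw [System.step_iff, mem_δ]
  have hc : c.src ≠ c.tgt := c.2
  constructor
  · rintro ⟨⟨-, h⟩, h', h''⟩
    simp only [Action.IsSend, Action.IsRecv, true_and, false_and, and_false, false_or] at h
    exact ⟨h.1, h.2, h' _ hc, h''⟩
  · rintro ⟨h1, h2, h3, h4⟩
    refine ⟨⟨rfl, .inr ⟨h1, trivial, h2⟩⟩, fun p hp => ?_, h4⟩
    obtain rfl := (src_eq_or_tgt_eq c p).resolve_right hp
    exact h3

/-- A channel holds a message if and only if it has been written and not yet read. -/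
def Inv (s : crossing.Config) : Prop := ∀ c,
  s.queue c = (if loc s c.src ≠ 0 ∧ loc s c.tgt ≠ 2 then [()] else []) ∧
    (loc s c.tgt = 2 → loc s c.src ≠ 0)

theorem inv_initial : Inv crossing.initial := by
  intro c
  have h : ∀ p, loc crossing.initial p = 0 := fun _ => rfl
  simp only [h]
  exact ⟨by simp [System.initial], by simp⟩

theorem Inv.isBounded {k : ℕ} (h : Inv s) (hk : 1 ≤ k) : s.IsBounded k := by
  intro c
  rw [(h c).1]
  split_ifs <;> simp [hk]

theorem Inv.step {l : Action Bool Unit} (h : Inv s) (hl : crossing.Step s l t) : Inv t := by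
  intro d
  cases l with
  | send c a =>
    obtain ⟨h1, h2, h3, h4⟩ := step_send.1 hl
    by_cases hd : d = c
    · subst hd
      have hs := h d
      have hq := h4.1
      rw [hs.1] at hq
      rw [hq, h2, h3, h1]
      rw [h1] at hs
      -- This is what the second clause of `Inv` is for: a reader cannot have finished before the
      -- writer has written.
      have : loc s d.tgt ≠ 2 := fun e => hs.2 e rfl
      simp [this]
    · rw [h4.2 d hd]
      obtain ⟨e1, e2⟩ := channel_ne hd
      have hs := h d
      rw [e1, e2] at hs ⊢
      rw [h2, h3, hs.1, h1]
      rw [h1] at hs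
      simp
  | recv c a =>
    obtain ⟨h1, h2, h3, h4⟩ := step_recv.1 hl
    by_cases hd : d = c
    · subst hd
      have hs := h d
      have hq := h4.1
      rw [hs.1] at hq
      rw [h2, h3]
      split_ifs at hq with hh
      simp only [List.cons.injEq, true_and] at hq
      exact ⟨by simp [← hq], fun _ => hh.1⟩
    · rw [h4.2 d hd]
      obtain ⟨e1, e2⟩ := channel_ne hd
      have hs := h d
      rw [e1, e2] at hs ⊢
      rw [h2, h3, hs.1, h1]
      simp

theorem Inv.bexec {k : ℕ} {φ : List (Action Bool Unit)} (h : Inv s)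
    (hφ : crossing.BExec k s φ t) : Inv t := by
  induction φ generalizing s with
  | nil => obtain ⟨-, rfl⟩ := hφ; exact h
  | cons l φ ih => obtain ⟨-, r, hr, hφ⟩ := hφ; exact ih (h.step hr) hφ

theorem exists_send {c : Channel Bool} (h : loc s c.src = 0) :
    ∃ t, crossing.Step s (.send c ()) t := by
  obtain ⟨w, hw⟩ := QueueStep.exists_send s.queue c ()
  obtain ⟨t, ht, -⟩ := System.exists_step (S := crossing) (l := .send c ()) (q' := (1 : Fin 3))
    (mem_δ.2 ⟨rfl, .inl ⟨h, trivial, rfl⟩⟩) hw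
  exact ⟨t, ht⟩

theorem Inv.exists_recv (hs : Inv s) {c : Channel Bool} (h : loc s c.src ≠ 0)
    (h' : loc s c.tgt = 1) : ∃ t, crossing.Step s (.recv c ()) t := by
  have hq := (hs c).1
  rw [if_pos ⟨h, by rw [h']; decide⟩] at hq
  obtain ⟨w, hw, -⟩ := QueueStep.exists_recv hq
  obtain ⟨t, ht, -⟩ := System.exists_step (S := crossing) (l := .recv c ()) (q' := (2 : Fin 3))
    (mem_δ.2 ⟨rfl, .inr ⟨h', trivial, rfl⟩⟩) hw
  exact ⟨t, ht⟩

theorem isCSA : crossing.IsCSA := by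
  refine fun p => ⟨fun q l q' h => (mem_δ.1 h).1, ?_, ?_⟩
  · rintro q l l' q' q'' h h' rfl
    obtain ⟨-, ⟨h1, h2, h3⟩ | ⟨h1, h2, h3⟩⟩ := mem_δ.1 h <;>
    obtain ⟨-, ⟨h1', h2', h3'⟩ | ⟨h1', h2', h3'⟩⟩ := mem_δ.1 h'
    · exact h3.trans h3'.symm
    · exact absurd (h1.symm.trans h1') (show (0 : Fin 3) ≠ 1 by decide)
    · exact absurd (h1.symm.trans h1') (show (1 : Fin 3) ≠ 0 by decide)
    · exact h3.trans h3'.symm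
  · rintro q ⟨h, h', h''⟩
    have hq : q ≠ (0 : Fin 3) := by
      intro hq
      refine h' ⟨h, fun l q' hl => ?_⟩
      obtain ⟨-, ⟨-, h, -⟩ | ⟨h, -⟩⟩ := mem_δ.1 hl
      · exact h
      · exact absurd (hq.symm.trans h) (show (0 : Fin 3) ≠ 1 by decide)
    refine h'' ⟨h, fun l q' hl => ?_⟩
    obtain ⟨-, ⟨h, -⟩ | ⟨-, h, -⟩⟩ := mem_δ.1 hl
    · exact absurd h hq
    · exact h

/-- With two participants the partner is determined by the subject, so directedness is automatic. -/
theorem obj_eq (l : Action Bool Unit) : l.obj = !l.subj := by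
  have h : ∀ c : Channel Bool, c.tgt = !c.src ∧ c.src = !c.tgt := by
    rintro ⟨⟨x, y⟩, h⟩
    revert h
    cases x <;> cases y <;> simp [Channel.src, Channel.tgt]
  cases l
  · exact (h _).1
  · exact (h _).2

theorem isDirected : crossing.IsDirected := by
  refine fun p => ⟨?_, ?_⟩ <;>
  · intro q l l' q' q'' _ h h'
    rw [obj_eq, obj_eq, (mem_δ.1 h).1, (mem_δ.1 h').1]

theorem isMC {k : ℕ} (hk : 1 ≤ k) : crossing.IsMC k := by
  have recv : ∀ s : crossing.Config, Inv s → ∀ c : Channel Bool, loc s c.src ≠ 0 →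
      loc s c.tgt = 1 → ∃ t, crossing.BExec k s [.recv c ()] t := by
    intro s hs c h h'
    obtain ⟨t, ht⟩ := hs.exists_recv h h'
    exact ⟨t, System.bexec_singleton.2 ⟨hs.isBounded hk, (hs.step ht).isBounded hk, ht⟩⟩
  have send : ∀ s : crossing.Config, Inv s → ∀ c : Channel Bool, loc s c.src = 0 →
      ∃ t, crossing.BExec k s [.send c ()] t := by
    intro s hs c h
    obtain ⟨t, ht⟩ := exists_send h
    exact ⟨t, System.bexec_singleton.2 ⟨hs.isBounded hk, (hs.step ht).isBounded hk, ht⟩⟩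
  have inv : ∀ s ∈ crossing.RS k, Inv s := fun s ⟨φ, hφ⟩ => inv_initial.bexec hφ
  refine ⟨fun s hs => ⟨fun c a x hx => ?_, fun p hp => ?_⟩, fun s hs p hp l q' hl => ?_⟩
  · have hs := inv s hs
    have hq := (hs c).1
    rw [hx] at hq
    split_ifs at hq with h
    -- A reader that has not yet sent must do so first; its send is always possible and leads to its
    -- receiving state.
    by_cases h0 : loc s c.tgt = 0
    · let d : Channel Bool := ⟨(c.tgt, c.src), c.2.symm⟩
      obtain ⟨t, ht⟩ := send s hs d h0
      obtain ⟨-, h1, h2, -⟩ := step_send.1 (System.bexec_singleton.1 ht).2.2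
      obtain ⟨t', ht'⟩ := recv t (hs.bexec ht) c
        (by rw [show loc t c.src = loc s c.src from h2]; exact h.1) h1
      exact ⟨_, t, t', ht, ht'⟩
    · have h1 : loc s c.tgt = 1 := by
        have h2 := h.2
        revert h0 h2
        generalize loc s c.tgt = i
        revert i
        decide
      obtain ⟨t, ht⟩ := recv s hs c h.1 h1
      exact ⟨[], s, t, ⟨hs.isBounded hk, rfl⟩, ht⟩
  · have hs := inv s hs
    obtain ⟨l, q', hl⟩ : ∃ l q', (s.state p, l, q') ∈ (crossing p).δ := by
      by_contra h
      exact hp.1 fun l q' hl => h ⟨l, q', hl⟩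
    have hp1 : loc s p = 1 := by
      obtain ⟨-, ⟨-, h, -⟩ | ⟨h, -⟩⟩ := mem_δ.1 hl
      · have := hp.2 _ _ hl
        cases l <;> simp_all [Action.IsSend, Action.IsRecv]
      · exact h
    -- If the partner has not yet sent, its send supplies the message; otherwise the message is
    -- already in the queue.
    by_cases h0 : loc s (!p) = 0
    · obtain ⟨t, ht⟩ := send s hs (chanTo p) h0
      obtain ⟨-, h1, h2, -⟩ := step_send.1 (System.bexec_singleton.1 ht).2.2
      obtain ⟨t', ht'⟩ := recv t (hs.bexec ht) (chanTo p) (by rw [h1]; decide) (h2.trans hp1)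
      exact ⟨chanTo p, (), _, t, t', rfl, ht, ht'⟩
    · obtain ⟨t, ht⟩ := recv s hs (chanTo p) h0 hp1
      exact ⟨chanTo p, (), [], s, t, rfl, ⟨hs.isBounded hk, rfl⟩, ht⟩
  · have hs := inv s hs
    have h := hp.2 _ _ hl
    cases l with
    | recv c a => exact h.elim
    | send c a =>
      obtain ⟨rfl, ⟨h0, -⟩ | ⟨-, h, -⟩⟩ := mem_δ.1 hl
      · obtain ⟨t, ht⟩ := send s hs c h0
        exact ⟨[], s, t, ⟨hs.isBounded hk, rfl⟩, ht, notIn_nil _⟩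
      · exact h.elim

theorem not_isSMC : ¬ crossing.IsSMC := by
  intro h
  have hl : (crossing.initial.state true, .send (chanFrom true) (), (1 : Fin 3)) ∈
      (crossing true).δ := mem_δ.2 ⟨rfl, .inl ⟨rfl, trivial, rfl⟩⟩
  have hi := System.initial_mem_stableReach (S := crossing)
  obtain ⟨φ, t, hφ, hex, hp⟩ := (h true _ hi.1 hi.2).1
    ⟨fun hf => hf _ _ hl, fun l q' hl' => by
      obtain ⟨_, rfl⟩ := System.send_of_send isCSA isDirected hl hl'
      trivial⟩ _ _ hl
  cases hφ with
  | nil => simp [proj] at hp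
  | cons c a φ _ =>
    obtain ⟨s₁, h₁, s₂, h₂, -⟩ := hex
    -- The first exchange fails: the reader is still in state `0`, where it can only send.
    have h1 := (step_send.1 h₁.step).2.2.1
    have h2 := (step_recv.1 h₂.step).1
    rw [h1] at h2
    exact absurd (show (0 : Fin 3) = 1 from h2) (by decide)

end crossing

end CommAut

theorem mainTheorem9 :
    (∀ (P : Type u) (A : Type v) [Finite P] [Finite A] (S : CommAut.System.{u, v, w} P A),
      S.IsCSA → S.IsDirected → S.IsSMC → S.IsMC 1) ∧
    (∀ k : ℕ, 0 < k →
      (∀ (P : Type u) (A : Type v) [Finite P] [Finite A] (S : CommAut.System.{u, v, w} P A),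
        S.IsCSA → S.IsDirected → S.IsSMC → S.IsMC k) ∧
      (∃ (P : Type) (A : Type) (_ : Finite P) (_ : Finite A) (S : CommAut.System.{0, 0, 0} P A),
        S.IsCSA ∧ S.IsDirected ∧ S.IsMC k ∧ ¬ S.IsSMC)) := by
  exact ⟨fun P A _ _ S hS hD hM => hM.isMC hS hD le_rfl, fun k hk =>
    ⟨fun P A _ _ S hS hD hM => hM.isMC hS hD hk, Bool, Unit, inferInstance, inferInstance,
      CommAut.crossing, CommAut.crossing.isCSA, CommAut.crossing.isDirected,
      CommAut.crossing.isMC hk, CommAut.crossing.not_isSMC⟩⟩
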